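/- Spherically symmetric initial data $(\mathcal M,g,K)$ consist of $\mathcal M=[\ell_0,\infty)\times S^2$ with $$g=d\ell^2+R(\ell)^2\,ds^2,\qquad K=K_\ell(\ell)\,d\ell^2+R(\ell)^2K_R(\ell)\,ds^2,$$ where $ds^2$ is the round metric of $S^2$, the functions $R,K_\ell,K_R$ are smooth on $[\ell_0,\infty)$ and $R>0$. Put $H=2(\partial_\ell R)/R$ and $\mathrm{tr}K=K_\ell+2K_R$. The outer and inner expansions of a surface with outward unit normal $\nu$ and mean curvature $H$ are $\theta^\pm=\mathrm{tr}_gK-K(\nu,\nu)\pm H$; the sphere at $\ell$ (denoted by $\ell$) is a MOTS if $\theta^+=0$ on it. The condition called here the dominant energy condition is $\rho\ge|\mu|$ at every point, where $$8\pi\rho=\mathrm{Scal}+|K|^2-(\mathrm{tr}K)^2,\qquad 8\pi\mu_i=2\bigl(\nabla^jK_{ij}-\nabla_i(\mathrm{tr}K)\bigr)$$ (these signs are those of the paper; in the usual Hamiltonian constraint the two quadratic terms in $K$ have the opposite signs). The decay conditions are, as $\ell\to\infty$, $$\frac{R^2}{\ell^2}-1=O(\ell^{-1}),\quad H-\frac2\ell=O(\ell^{-2}),\quad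 \partial_\ell H+\frac2{\ell^2}=O(\ell^{-3}),$$ $$K_\ell,\,K_R=O(\ell^{-2}),\quad \partial_\ell K_\ell,\,\partial_\ell K_R=O(\ell^{-3}),\quad \mathrm{tr}K=O(\ell^{-3}).$$ A blow-up solution for the sphere at $\ell_*$ is a function $k\in C^\infty([\ell_*,\infty))$ that solves the spherically symmetric Jang equation $\partial_\ell(R^2k)-R^2(\mathrm{tr}K-K_\ell k^2)=0$ on $[\ell_*,\infty)$ with $k(\ell_*)=-1$, $\partial_\ell k(\ell_*)=0$, $|k(\ell)|<1$ for all $\ell>\ell_*$, and $k(\ell)\to0$ as $\ell\to\infty$. **Proposition 4.** There exist spherically symmetric initial data with $K$ not identically zero that satisfy the dominant energy condition, the decay conditions, and either $\theta^-<0$ on all round spheres or $\mathrm{tr}K<0$ everywhere, and that contain two MOTSs at $\ell_1<\ell_2$, with $\ell_0<\ell_1$, such that $R(\ell_1)>R(\ell_2)$ and a blow-up solution exists for $\ell_1$. In particular the sphere at $\ell_2$, which encloses the one at $\ell_1$, has strictly smaller area, so the MOTS at $\ell_1$ has a blow-up solution but is not outer-area-minimizing. -/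

import Mathlib

open scoped ContDiff

/-! ### Tensor calculus in a coordinate chart of a Riemannian 3-manifold -/

namespace ChartGeometry

/-- Coordinates of a point of a three-dimensional chart. -/
abbrev Pt : Type := Fin 3 → ℝ

/-- The components of a covariant 2-tensor field in a chart. -/
abbrev Tensor2 : Type := Pt → Matrix (Fin 3) (Fin 3) ℝ

/-- The partial derivative `∂ᵢ f`. -/
noncomputable def pd (i : Fin 3) (f : Pt → ℝ) (x : Pt) : ℝ :=
  deriv (fun t : ℝ => f (Function.update x i t)) (x i)

/-- The Christoffel symbol `Γᵏᵢⱼ` of the metric `g`. -/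
noncomputable def christoffel (g : Tensor2) (k i j : Fin 3) (x : Pt) : ℝ :=
  (1 / 2) * ∑ l : Fin 3, (g x)⁻¹ k l *
    (pd i (fun y => g y j l) x + pd j (fun y => g y i l) x - pd l (fun y => g y i j) x)

/-- The Ricci tensor `Rᵢⱼ = ∂ₖ Γᵏᵢⱼ - ∂ⱼ Γᵏᵢₖ + Γᵏₖₗ Γˡᵢⱼ - Γᵏⱼₗ Γˡᵢₖ`. -/
noncomputable def ricci (g : Tensor2) (i j : Fin 3) (x : Pt) : ℝ :=
  ∑ k : Fin 3, (pd k (christoffel g k i j) x - pd j (christoffel g k i k) x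
    + ∑ l : Fin 3, (christoffel g k k l x * christoffel g l i j x
        - christoffel g k j l x * christoffel g l i k x))

/-- The scalar curvature `gⁱʲ Rᵢⱼ`. -/
noncomputable def scal (g : Tensor2) (x : Pt) : ℝ :=
  ∑ i : Fin 3, ∑ j : Fin 3, (g x)⁻¹ i j * ricci g i j x

/-- The trace `gⁱʲ Kᵢⱼ`. -/
noncomputable def trace (g K : Tensor2) (x : Pt) : ℝ :=
  ∑ i : Fin 3, ∑ j : Fin 3, (g x)⁻¹ i j * K x i j

/-- The squared norm `|K|² = gⁱᵏ gʲˡ Kᵢⱼ Kₖₗ`. -/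
noncomputable def normSq (g K : Tensor2) (x : Pt) : ℝ :=
  ∑ i : Fin 3, ∑ j : Fin 3, ∑ k : Fin 3, ∑ l : Fin 3,
    (g x)⁻¹ i k * (g x)⁻¹ j l * K x i j * K x k l

/-- The covariant derivative `∇ₖ Kᵢⱼ = ∂ₖ Kᵢⱼ - Γˡₖᵢ Kₗⱼ - Γˡₖⱼ Kᵢₗ`. -/
noncomputable def covDeriv (g K : Tensor2) (k i j : Fin 3) (x : Pt) : ℝ :=
  pd k (fun y => K y i j) x
    - ∑ l : Fin 3, (christoffel g l k i x * K x l j + christoffel g l k j x * K x i l)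

/-- The divergence `∇ʲ Kᵢⱼ`. -/
noncomputable def divergence (g K : Tensor2) (i : Fin 3) (x : Pt) : ℝ :=
  ∑ j : Fin 3, ∑ k : Fin 3, (g x)⁻¹ j k * covDeriv g K k i j x

/-- The energy density `ρ`, given by `8πρ = Scal + |K|² - (tr K)²`. -/
noncomputable def energyDensity (g K : Tensor2) (x : Pt) : ℝ :=
  (scal g x + normSq g K x - trace g K x ^ 2) / (8 * Real.pi)

/-- The momentum density `μᵢ`, given by `8πμᵢ = 2 (∇ʲ Kᵢⱼ - ∇ᵢ (tr K))`. -/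
noncomputable def momentumDensity (g K : Tensor2) (i : Fin 3) (x : Pt) : ℝ :=
  2 * (divergence g K i x - pd i (trace g K) x) / (8 * Real.pi)

/-- The length `|μ| = (gⁱʲ μᵢ μⱼ)^(1/2)` of the momentum density. -/
noncomputable def momentumNorm (g K : Tensor2) (x : Pt) : ℝ :=
  Real.sqrt (∑ i : Fin 3, ∑ j : Fin 3,
    (g x)⁻¹ i j * momentumDensity g K i x * momentumDensity g K j x)

/-- The coordinate vector field `∂₀`. -/
def e0 : Pt := Pi.single 0 1

/-- The divergence `∇ᵢ νⁱ` of the vector field `ν = ∂₀`. When `∂₀` is the unit normal field of the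
level sets of the coordinate `x₀`, this is their mean curvature with respect to `∂₀`. -/
noncomputable def meanCurvature (g : Tensor2) (x : Pt) : ℝ :=
  ∑ i : Fin 3, ∑ j : Fin 3, christoffel g i i j x * e0 j

/-- `tr K - K(ν, ν)` with `ν = ∂₀`. -/
noncomputable def tangentialTrace (g K : Tensor2) (x : Pt) : ℝ :=
  trace g K x - ∑ i : Fin 3, ∑ j : Fin 3, K x i j * e0 i * e0 j

/-- The outer expansion `θ⁺ = tr K - K(ν, ν) + H` of the level set of `x₀` through `x`. -/
noncomputable def outerExpansion (g K : Tensor2) (x : Pt) : ℝ :=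
  tangentialTrace g K x + meanCurvature g x

/-- The inner expansion `θ⁻ = tr K - K(ν, ν) - H` of the level set of `x₀` through `x`. -/
noncomputable def innerExpansion (g K : Tensor2) (x : Pt) : ℝ :=
  tangentialTrace g K x - meanCurvature g x

end ChartGeometry

/-! ### Spherically symmetric initial data -/

/-- Spherically symmetric initial data on `M = [ℓ₀, ∞) × S²`, with the radial coordinate `ℓ`
measuring proper distance:
`g = dℓ² + R(ℓ)² ds²` and `K = K_ℓ(ℓ) dℓ² + R(ℓ)² K_R(ℓ) ds²`, `ds²` the round metric of `S²`.
Smooth functions on `[ℓ₀, ∞)` are represented by smooth extensions to `ℝ`; the values to the left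
of `ℓ₀` are irrelevant, and the derivatives at points `ℓ ≥ ℓ₀` do not depend on the extension. -/
structure SphericalData where
  ℓ₀ : ℝ
  R : ℝ → ℝ
  Kl : ℝ → ℝ
  KR : ℝ → ℝ
  smooth_R : ContDiff ℝ ∞ R
  smooth_Kl : ContDiff ℝ ∞ Kl
  smooth_KR : ContDiff ℝ ∞ KR
  R_pos : ∀ ℓ, ℓ₀ ≤ ℓ → 0 < R ℓ

namespace SphericalData

open ChartGeometry

/-- The metric in the coordinates `(ℓ, ϑ, φ)`, where `ds² = dϑ² + sin² ϑ dφ²`. -/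
noncomputable def metric (d : SphericalData) : Tensor2 := fun x =>
  Matrix.diagonal ![1, d.R (x 0) ^ 2, d.R (x 0) ^ 2 * Real.sin (x 1) ^ 2]

/-- The second fundamental form in the coordinates `(ℓ, ϑ, φ)`. -/
noncomputable def secondForm (d : SphericalData) : Tensor2 := fun x =>
  Matrix.diagonal ![d.Kl (x 0), d.R (x 0) ^ 2 * d.KR (x 0),
    d.R (x 0) ^ 2 * d.KR (x 0) * Real.sin (x 1) ^ 2]

/-- The coordinate domain of `M = [ℓ₀, ∞) × S²`, with the two poles of the spheres removed. -/
def chart (d : SphericalData) : Set Pt :=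
  {x | d.ℓ₀ ≤ x 0 ∧ 0 < x 1 ∧ x 1 < Real.pi}

/-- The function `H = 2 (∂_ℓ R) / R`. -/
noncomputable def H (d : SphericalData) (ℓ : ℝ) : ℝ := 2 * deriv d.R ℓ / d.R ℓ

/-- The function `tr K = K_ℓ + 2 K_R`. -/
def trK (d : SphericalData) (ℓ : ℝ) : ℝ := d.Kl ℓ + 2 * d.KR ℓ

/-- The dominant energy condition `ρ ≥ |μ|` on `M`. -/
def DominantEnergy (d : SphericalData) : Prop :=
  ∀ x ∈ d.chart, momentumNorm d.metric d.secondForm x ≤ energyDensity d.metric d.secondForm x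

/-- The decay conditions at infinity. -/
structure Decay (d : SphericalData) : Prop where
  areaRadius : (fun ℓ => d.R ℓ ^ 2 / ℓ ^ 2 - 1) =O[Filter.atTop] (fun ℓ : ℝ => ℓ⁻¹)
  meanCurv : (fun ℓ => d.H ℓ - 2 / ℓ) =O[Filter.atTop] (fun ℓ : ℝ => (ℓ ^ 2)⁻¹)
  deriv_meanCurv : (fun ℓ => deriv d.H ℓ + 2 / ℓ ^ 2) =O[Filter.atTop] (fun ℓ : ℝ => (ℓ ^ 3)⁻¹)
  Kl : d.Kl =O[Filter.atTop] (fun ℓ : ℝ => (ℓ ^ 2)⁻¹)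
  KR : d.KR =O[Filter.atTop] (fun ℓ : ℝ => (ℓ ^ 2)⁻¹)
  deriv_Kl : deriv d.Kl =O[Filter.atTop] (fun ℓ : ℝ => (ℓ ^ 3)⁻¹)
  deriv_KR : deriv d.KR =O[Filter.atTop] (fun ℓ : ℝ => (ℓ ^ 3)⁻¹)
  trK : d.trK =O[Filter.atTop] (fun ℓ : ℝ => (ℓ ^ 3)⁻¹)

/-- `K` does not vanish identically on `M`. -/
def NonzeroK (d : SphericalData) : Prop := ∃ x ∈ d.chart, d.secondForm x ≠ 0

/-- `tr K < 0` everywhere on `M`. -/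
def NegativeTrace (d : SphericalData) : Prop :=
  ∀ x ∈ d.chart, trace d.metric d.secondForm x < 0

/-- `θ⁻ < 0` everywhere on `M`. -/
def NegativeInnerExpansion (d : SphericalData) : Prop :=
  ∀ x ∈ d.chart, innerExpansion d.metric d.secondForm x < 0

/-- The round sphere at `ℓ` is a marginally outer trapped surface: `θ⁺ = 0` at all its points. -/
def IsMOTS (d : SphericalData) (ℓ : ℝ) : Prop :=
  d.ℓ₀ ≤ ℓ ∧ ∀ x ∈ d.chart, x 0 = ℓ → outerExpansion d.metric d.secondForm x = 0

/-- The area of the round sphere at `ℓ`: the integral of the area element of the metric induced by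
`g` in the coordinates `(ϑ, φ)`. -/
noncomputable def sphereArea (d : SphericalData) (ℓ : ℝ) : ℝ :=
  ∫ ϑ in (0 : ℝ)..Real.pi, ∫ φ in (0 : ℝ)..(2 * Real.pi),
    Real.sqrt ((d.metric ![ℓ, ϑ, φ]).submatrix Fin.succ Fin.succ : Matrix (Fin 2) (Fin 2) ℝ).det

/-- `k` solves the Jang equation in spherical symmetry,
`∂_ℓ (R² k) - R² (tr K - K_ℓ k²) = 0`, on `[s, ∞)`. -/
def SolvesJang (d : SphericalData) (s : ℝ) (k : ℝ → ℝ) : Prop :=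
  ∀ ℓ, s ≤ ℓ →
    derivWithin (fun t => d.R t ^ 2 * k t) (Set.Ici s) ℓ
      - d.R ℓ ^ 2 * (d.trK ℓ - d.Kl ℓ * k ℓ ^ 2) = 0

/-- `k` is a blow-up solution for the round sphere at `s`. -/
structure IsBlowUpSolution (d : SphericalData) (s : ℝ) (k : ℝ → ℝ) : Prop where
  smooth : ContDiffOn ℝ ∞ k (Set.Ici s)
  jang : d.SolvesJang s k
  value : k s = -1
  deriv_eq : derivWithin k (Set.Ici s) s = 0
  abs_lt : ∀ ℓ, s < ℓ → |k ℓ| < 1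
  tendsto : Filter.Tendsto k Filter.atTop (nhds 0)

end SphericalData

/-!
The Jang equation is algebraic in `K_R`: once the area radius `R`, the function `k` and `K_ℓ` are
chosen, exactly one `K_R` makes `k` a solution. So `R` and `k` are prescribed here, `K_ℓ` is `2q /
R³` with a large constant `q`, and `K_R` is computed (`jangKR`). Then `θ⁺ = 2 (K_R + R'/R)` vanishes
automatically at a point with `k = -1` and `k' = 0`; on an interval where `k = 0`, `K` is the
trace-free and divergence-free tensor with components `2q / R³` and `-q / R³`, and `θ⁺ = 0` means
`R² R' = q`.

The function `k` rises monotonically from `-1` at `ℓ₁ = 0` to `0`, where it stays. The radius grows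
exponentially near `ℓ₁`, shrinks to `1` once `k = 0`, and then opens up to flat space with `R' = 1`.
The second MOTS is the sphere of radius `Q = √q` in the flat part. Since `R(ℓ₁) = 1 + A` can be
chosen at will, it can be made larger than `Q`.

The energy condition has two causes. The passage to flat space needs a bounded amount of negative
scalar curvature on a fixed compact set; there `μ = 0`, and the term `3 q² / R⁶` coming from `K`,
which in the present sign convention is positive, dominates for large `q`
(`exists_forall_flare_energy`). Everything before the passage is slowed down, `R = ρ(ε ℓ)` and `k =
κ(ε ℓ)`: as `ε → 0`, all derivatives disappear, and what remains of `ρ - |μ|` is positive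
(`eventually_energyMargin_scale_pos`).

The inequality `θ⁻ < 0`, that is `K_R < R'/R`, follows from `K_R = -q / R³` and `R' ≥ 0` in the
outer part, and from the same limit `ε → 0` where `k = 0` in the inner part
(`eventually_jangKR_scale_lt`). Where `k` rises it holds because the exponential rate `c` of the
radius exceeds the derivative of `κ` (`jangKR_scale_lt_of_logDeriv`).
-/

open ChartGeometry Filter Topology

/-! ### Coordinate derivatives and curvature of a spherically symmetric metric -/

namespace ChartGeometry

theorem pd_congr_of_isOpen {U : Set Pt} (hU : IsOpen U) {f g : Pt → ℝ} (h : ∀ y ∈ U, f y = g y)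
    (i : Fin 3) {x : Pt} (hx : x ∈ U) : pd i f x = pd i g x := by
  have hc : Continuous fun t : ℝ => Function.update x i t := continuous_const.update i continuous_id
  have hm : Function.update x i (x i) ∈ U := by simpa using hx
  refine Filter.EventuallyEq.deriv_eq ?_
  filter_upwards [hc.continuousAt.preimage_mem_nhds (hU.mem_nhds hm)] with t ht using h _ ht

theorem pd_zero_eq (F : ℝ → ℝ → ℝ) (x : Pt) :
    pd 0 (fun y => F (y 0) (y 1)) x = deriv (fun t => F t (x 1)) (x 0) := by
  simp [pd]

theorem pd_one_eq (F : ℝ → ℝ → ℝ) (x : Pt) :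
    pd 1 (fun y => F (y 0) (y 1)) x = deriv (fun t => F (x 0) t) (x 1) := by
  simp [pd]

theorem pd_two_eq (F : ℝ → ℝ → ℝ) (x : Pt) : pd 2 (fun y => F (y 0) (y 1)) x = 0 := by
  simp [pd]

theorem pd_const (i : Fin 3) (c : ℝ) (x : Pt) : pd i (fun _ => c) x = 0 := by
  simp [pd]

end ChartGeometry

namespace SphericalData

variable (d : SphericalData)

/-- The points of the coordinate space at which the metric is nondegenerate. It contains the chart
of `M` and is open, so that coordinate derivatives can be computed in it also at the boundary `ℓ =
ℓ₀`. -/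
def regularChart : Set Pt := {x | d.R (x 0) ≠ 0 ∧ Real.sin (x 1) ≠ 0}

theorem isOpen_regularChart : IsOpen d.regularChart := by
  have h0 : Continuous fun x : Pt => d.R (x 0) := d.smooth_R.continuous.comp (continuous_apply 0)
  have h1 : Continuous fun x : Pt => Real.sin (x 1) := Real.continuous_sin.comp (continuous_apply 1)
  exact (isOpen_ne_fun h0 continuous_const).inter (isOpen_ne_fun h1 continuous_const)

theorem chart_subset_regularChart : d.chart ⊆ d.regularChart := fun _ hx =>
  ⟨(d.R_pos _ hx.1).ne', (Real.sin_pos_of_pos_of_lt_pi hx.2.1 hx.2.2).ne'⟩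

theorem metric_inv {x : Pt} (hx : x ∈ d.regularChart) :
    (d.metric x)⁻¹ = Matrix.diagonal
      ![1, (d.R (x 0) ^ 2)⁻¹, (d.R (x 0) ^ 2 * Real.sin (x 1) ^ 2)⁻¹] := by
  obtain ⟨h0, h1⟩ := hx
  refine Matrix.inv_eq_right_inv ?_
  rw [metric, Matrix.diagonal_mul_diagonal, ← Matrix.diagonal_one]
  congr 1
  ext i
  fin_cases i
  · simp
  · simp [h0]
  · simpa using mul_inv_cancel₀ (mul_ne_zero (pow_ne_zero 2 h0) (pow_ne_zero 2 h1))

/-- The Christoffel symbols `Γᵏᵢⱼ` of `dℓ² + R² (dϑ² + sin² ϑ dφ²)`, with the arguments in the order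
`ℓ ϑ k i j`. -/
noncomputable def polarChristoffel (r ϑ : ℝ) : Fin 3 → Fin 3 → Fin 3 → ℝ
  | 0, 1, 1 => -(d.R r * deriv d.R r)
  | 0, 2, 2 => -(d.R r * deriv d.R r * Real.sin ϑ ^ 2)
  | 1, 0, 1 => deriv d.R r / d.R r
  | 1, 1, 0 => deriv d.R r / d.R r
  | 1, 2, 2 => -(Real.sin ϑ * Real.cos ϑ)
  | 2, 0, 2 => deriv d.R r / d.R r
  | 2, 2, 0 => deriv d.R r / d.R r
  | 2, 1, 2 => Real.cos ϑ / Real.sin ϑ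
  | 2, 2, 1 => Real.cos ϑ / Real.sin ϑ
  | _, _, _ => 0

/-- The derivatives `∂ₘ gᵢᵢ` of the diagonal components of `g = dℓ² + R² (dϑ² + sin² ϑ dφ²)`, with
the arguments in the order `ℓ ϑ m i`. -/
noncomputable def polarMetricDeriv (r ϑ : ℝ) : Fin 3 → Fin 3 → ℝ
  | 0, 1 => 2 * d.R r * deriv d.R r
  | 0, 2 => 2 * d.R r * deriv d.R r * Real.sin ϑ ^ 2
  | 1, 2 => d.R r ^ 2 * (2 * Real.sin ϑ * Real.cos ϑ)
  | _, _ => 0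

theorem differentiable_R : Differentiable ℝ d.R := d.smooth_R.differentiable (by simp)

theorem differentiable_deriv_R : Differentiable ℝ (deriv d.R) :=
  ((contDiff_infty_iff_deriv.1 d.smooth_R).2).differentiable (by simp)

theorem pd_diagonal (m i j : Fin 3) (v : Pt → Fin 3 → ℝ) (x : Pt) :
    pd m (fun y => (Matrix.diagonal (v y) : Matrix (Fin 3) (Fin 3) ℝ) i j) x =
      if i = j then pd m (fun y => v y i) x else 0 := by
  split_ifs with h
  · simp [h]
  · simp [h, pd]

theorem pd_metric (m i j : Fin 3) (x : Pt) : pd m (fun y => d.metric y i j) x =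
    if i = j then d.polarMetricDeriv (x 0) (x 1) m i else 0 := by
  have hR := d.differentiable_R
  have e0 : deriv (fun t => d.R t ^ 2) (x 0) = 2 * d.R (x 0) * deriv d.R (x 0) := by
    simp [hR (x 0)]
  have e1 : deriv (fun t => Real.sin t ^ 2) (x 1) = 2 * Real.sin (x 1) * Real.cos (x 1) := by
    simp
  refine (pd_diagonal m i j _ x).trans ?_
  congr 1
  fin_cases m <;> fin_cases i
  · simp [pd, polarMetricDeriv]
  · exact (pd_zero_eq (fun r _ => d.R r ^ 2) x).trans e0
  · exact (pd_zero_eq (fun r ϑ => d.R r ^ 2 * Real.sin ϑ ^ 2) x).trans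
      ((deriv_mul_const_field _).trans (by rw [e0]; rfl))
  · simp [pd, polarMetricDeriv]
  · exact (pd_one_eq (fun r _ => d.R r ^ 2) x).trans (deriv_const _ _)
  · exact (pd_one_eq (fun r ϑ => d.R r ^ 2 * Real.sin ϑ ^ 2) x).trans
      ((deriv_const_mul_field _).trans (by rw [e1]; rfl))
  · simp [pd, polarMetricDeriv]
  · exact pd_two_eq (fun r _ => d.R r ^ 2) x
  · exact pd_two_eq (fun r ϑ => d.R r ^ 2 * Real.sin ϑ ^ 2) x

theorem christoffel_metric (k i j : Fin 3) {x : Pt} (hx : x ∈ d.regularChart) :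
    christoffel d.metric k i j x = d.polarChristoffel (x 0) (x 1) k i j := by
  rw [christoffel, d.metric_inv hx, Finset.sum_eq_single k
    (fun l _ hl => by rw [Matrix.diagonal_apply_ne _ hl.symm, zero_mul]) (by simp),
    Matrix.diagonal_apply_eq]
  simp only [pd_metric]
  obtain ⟨h0, h1⟩ := hx
  fin_cases k <;> fin_cases i <;> fin_cases j <;>
    simp [polarMetricDeriv, polarChristoffel] <;> field_simp

/-- The derivatives `∂ₘ Γᵏᵢⱼ` of the Christoffel symbols of `dℓ² + R² (dϑ² + sin² ϑ dφ²)`, with the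
arguments in the order `ℓ ϑ m k i j`. -/
noncomputable def polarChristoffelDeriv (r ϑ : ℝ) : Fin 3 → Fin 3 → Fin 3 → Fin 3 → ℝ
  | 0, 0, 1, 1 => -(deriv d.R r ^ 2 + d.R r * deriv (deriv d.R) r)
  | 0, 0, 2, 2 => -((deriv d.R r ^ 2 + d.R r * deriv (deriv d.R) r) * Real.sin ϑ ^ 2)
  | 0, 1, 0, 1 => deriv (deriv d.R) r / d.R r - (deriv d.R r / d.R r) ^ 2
  | 0, 1, 1, 0 => deriv (deriv d.R) r / d.R r - (deriv d.R r / d.R r) ^ 2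
  | 0, 2, 0, 2 => deriv (deriv d.R) r / d.R r - (deriv d.R r / d.R r) ^ 2
  | 0, 2, 2, 0 => deriv (deriv d.R) r / d.R r - (deriv d.R r / d.R r) ^ 2
  | 1, 0, 2, 2 => -(d.R r * deriv d.R r * (2 * Real.sin ϑ * Real.cos ϑ))
  | 1, 1, 2, 2 => Real.sin ϑ ^ 2 - Real.cos ϑ ^ 2
  | 1, 2, 1, 2 => -(1 / Real.sin ϑ ^ 2)
  | 1, 2, 2, 1 => -(1 / Real.sin ϑ ^ 2)
  | _, _, _, _ => 0

theorem pd_christoffel (m k i j : Fin 3) {x : Pt} (hx : x ∈ d.regularChart) :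
    pd m (christoffel d.metric k i j) x = d.polarChristoffelDeriv (x 0) (x 1) m k i j := by
  rw [pd_congr_of_isOpen d.isOpen_regularChart
    (fun y hy => d.christoffel_metric k i j hy) m hx]
  obtain ⟨h0, h1⟩ := hx
  have hR := (d.differentiable_R (x 0)).hasDerivAt
  have hR' := (d.differentiable_deriv_R (x 0)).hasDerivAt
  have eA : deriv (fun t => d.R t * deriv d.R t) (x 0)
      = deriv d.R (x 0) ^ 2 + d.R (x 0) * deriv (deriv d.R) (x 0) := by
    rw [(hR.fun_mul hR').deriv]; ring
  have eB : deriv (fun t => deriv d.R t / d.R t) (x 0)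
      = deriv (deriv d.R) (x 0) / d.R (x 0) - (deriv d.R (x 0) / d.R (x 0)) ^ 2 := by
    rw [(hR'.fun_div hR h0).deriv]; field_simp
  have eC : deriv (fun t => Real.sin t ^ 2) (x 1) = 2 * Real.sin (x 1) * Real.cos (x 1) := by
    simp
  have eD : deriv (fun t => Real.sin t * Real.cos t) (x 1)
      = -(Real.sin (x 1) ^ 2 - Real.cos (x 1) ^ 2) := by
    rw [((Real.hasDerivAt_sin _).fun_mul (Real.hasDerivAt_cos _)).deriv]; ring
  have eE : deriv (fun t => Real.cos t / Real.sin t) (x 1) = -(1 / Real.sin (x 1) ^ 2) := by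
    rw [((Real.hasDerivAt_cos _).fun_div (Real.hasDerivAt_sin _) h1).deriv]
    field_simp
    linarith [Real.sin_sq_add_cos_sq (x 1)]
  fin_cases m
  · refine (pd_zero_eq (fun r ϑ => d.polarChristoffel r ϑ k i j) x).trans ?_
    fin_cases k <;> fin_cases i <;> fin_cases j <;>
      simp only [polarChristoffel, polarChristoffelDeriv, Fin.mk_zero, Fin.mk_one,
        Fin.reduceFinMk, deriv.fun_neg, deriv_mul_const_field, eA, eB, deriv_const, zero_mul,
        neg_zero]
  · refine (pd_one_eq (fun r ϑ => d.polarChristoffel r ϑ k i j) x).trans ?_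
    fin_cases k <;> fin_cases i <;> fin_cases j <;>
      simp only [polarChristoffel, polarChristoffelDeriv, Fin.mk_zero, Fin.mk_one,
        Fin.reduceFinMk, deriv.fun_neg, deriv_const_mul_field, eC, eD, eE, deriv_const, neg_neg,
        mul_zero, neg_zero]
  · refine (pd_two_eq (fun r ϑ => d.polarChristoffel r ϑ k i j) x).trans ?_
    fin_cases k <;> fin_cases i <;> fin_cases j <;> rfl

theorem scal_metric {x : Pt} (hx : x ∈ d.regularChart) :
    scal d.metric x = -4 * deriv (deriv d.R) (x 0) / d.R (x 0)
      + 2 * (1 - deriv d.R (x 0) ^ 2) / d.R (x 0) ^ 2 := by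
  have hcs := Real.cos_sq' (x 1)
  have h0 := hx.1
  have h1 := hx.2
  have r0 : ricci d.metric 0 0 x = -2 * deriv (deriv d.R) (x 0) / d.R (x 0) := by
    simp only [ricci, d.pd_christoffel _ _ _ _ hx, d.christoffel_metric _ _ _ hx,
      Fin.sum_univ_three, polarChristoffel, polarChristoffelDeriv]
    field_simp
    ring
  have r1 : ricci d.metric 1 1 x
      = 1 - deriv d.R (x 0) ^ 2 - d.R (x 0) * deriv (deriv d.R) (x 0) := by
    simp only [ricci, d.pd_christoffel _ _ _ _ hx, d.christoffel_metric _ _ _ hx,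
      Fin.sum_univ_three, polarChristoffel, polarChristoffelDeriv]
    field_simp
    rw [hcs]
    ring
  have r2 : ricci d.metric 2 2 x
      = (1 - deriv d.R (x 0) ^ 2 - d.R (x 0) * deriv (deriv d.R) (x 0)) * Real.sin (x 1) ^ 2 := by
    simp only [ricci, d.pd_christoffel _ _ _ _ hx, d.christoffel_metric _ _ _ hx,
      Fin.sum_univ_three, polarChristoffel, polarChristoffelDeriv]
    field_simp
    rw [hcs]
    ring
  rw [scal, d.metric_inv hx]
  simp only [Fin.sum_univ_three, Matrix.diagonal_apply, r0, r1, r2]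
  simp
  field_simp
  ring

/-! ### Constraint densities, expansions and areas in terms of the radial functions -/

theorem trace_secondForm {x : Pt} (hx : x ∈ d.regularChart) :
    trace d.metric d.secondForm x = d.trK (x 0) := by
  have h0 := hx.1
  have h1 := hx.2
  rw [trace, d.metric_inv hx]
  simp only [Fin.sum_univ_three, secondForm, Matrix.diagonal_apply, trK]
  simp
  field_simp
  ring

theorem normSq_secondForm {x : Pt} (hx : x ∈ d.regularChart) :
    normSq d.metric d.secondForm x = d.Kl (x 0) ^ 2 + 2 * d.KR (x 0) ^ 2 := by
  have h0 := hx.1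
  have h1 := hx.2
  rw [normSq, d.metric_inv hx]
  simp only [Fin.sum_univ_three, secondForm, Matrix.diagonal_apply]
  simp
  field_simp
  ring

theorem meanCurvature_metric {x : Pt} (hx : x ∈ d.regularChart) :
    meanCurvature d.metric x = d.H (x 0) := by
  simp only [meanCurvature, d.christoffel_metric _ _ _ hx, Fin.sum_univ_three, polarChristoffel,
    e0, H]
  simp
  ring

theorem tangentialTrace_secondForm {x : Pt} (hx : x ∈ d.regularChart) :
    tangentialTrace d.metric d.secondForm x = 2 * d.KR (x 0) := by
  rw [tangentialTrace, d.trace_secondForm hx]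
  simp [Fin.sum_univ_three, secondForm, e0, trK]

theorem divergence_zero {x : Pt} (hx : x ∈ d.regularChart) :
    divergence d.metric d.secondForm 0 x
      = deriv d.Kl (x 0) + d.H (x 0) * (d.Kl (x 0) - d.KR (x 0)) := by
  have h0 := hx.1
  have h1 := hx.2
  have p : pd 0 (fun y => d.Kl (y 0)) x = deriv d.Kl (x 0) := pd_zero_eq (fun r _ => d.Kl r) x
  rw [divergence, d.metric_inv hx]
  simp only [covDeriv, d.christoffel_metric _ _ _ hx, Fin.sum_univ_three,
    polarChristoffel, Matrix.diagonal_apply, secondForm, H]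
  simp [p, pd_const]
  field_simp
  ring

theorem divergence_one {x : Pt} (hx : x ∈ d.regularChart) :
    divergence d.metric d.secondForm 1 x = 0 := by
  have h0 := hx.1
  have h1 := hx.2
  have p : pd 1 (fun y => d.R (y 0) ^ 2 * d.KR (y 0)) x = 0 :=
    (pd_one_eq (fun r _ => d.R r ^ 2 * d.KR r) x).trans (deriv_const _ _)
  rw [divergence, d.metric_inv hx]
  simp only [covDeriv, d.christoffel_metric _ _ _ hx, Fin.sum_univ_three,
    polarChristoffel, Matrix.diagonal_apply, secondForm]
  simp [p, pd_const, -mul_eq_zero]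
  field_simp
  ring

theorem divergence_two {x : Pt} (hx : x ∈ d.regularChart) :
    divergence d.metric d.secondForm 2 x = 0 := by
  have h0 := hx.1
  have h1 := hx.2
  have p : pd 2 (fun y => d.R (y 0) ^ 2 * d.KR (y 0) * Real.sin (y 1) ^ 2) x = 0 :=
    pd_two_eq (fun r ϑ => d.R r ^ 2 * d.KR r * Real.sin ϑ ^ 2) x
  rw [divergence, d.metric_inv hx]
  simp only [covDeriv, d.christoffel_metric _ _ _ hx, Fin.sum_univ_three,
    polarChristoffel, Matrix.diagonal_apply, secondForm]
  simp [p, pd_const]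

theorem pd_trace (i : Fin 3) {x : Pt} (hx : x ∈ d.regularChart) :
    pd i (trace d.metric d.secondForm) x = if i = 0 then deriv d.trK (x 0) else 0 := by
  rw [pd_congr_of_isOpen d.isOpen_regularChart (fun y hy => d.trace_secondForm hy) i hx]
  fin_cases i
  · exact pd_zero_eq (fun r _ => d.trK r) x
  · exact (pd_one_eq (fun r _ => d.trK r) x).trans (deriv_const _ _)
  · exact pd_two_eq (fun r _ => d.trK r) x

theorem momentumNorm_eq {x : Pt} (hx : x ∈ d.regularChart) :
    momentumNorm d.metric d.secondForm x
      = |2 * (d.H (x 0) * (d.Kl (x 0) - d.KR (x 0)) - 2 * deriv d.KR (x 0))| / (8 * Real.pi) := by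
  have ht : deriv d.trK (x 0) = deriv d.Kl (x 0) + 2 * deriv d.KR (x 0) := by
    have hl := (d.smooth_Kl.differentiable (by simp) (x 0)).hasDerivAt
    have hr := (d.smooth_KR.differentiable (by simp) (x 0)).hasDerivAt
    exact (hl.fun_add (hr.const_mul 2)).deriv
  have m1 : momentumDensity d.metric d.secondForm 1 x = 0 := by
    simp [momentumDensity, d.divergence_one hx, d.pd_trace 1 hx]
  have m2 : momentumDensity d.metric d.secondForm 2 x = 0 := by
    simp [momentumDensity, d.divergence_two hx, d.pd_trace 2 hx]
  have m0 : momentumDensity d.metric d.secondForm 0 x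
      = 2 * (d.H (x 0) * (d.Kl (x 0) - d.KR (x 0)) - 2 * deriv d.KR (x 0)) / (8 * Real.pi) := by
    rw [momentumDensity, d.divergence_zero hx, d.pd_trace 0 hx, if_pos rfl, ht]
    ring
  have hpi : (0 : ℝ) < 8 * Real.pi := by positivity
  rw [momentumNorm, d.metric_inv hx]
  simp only [Fin.sum_univ_three, m1, m2, Matrix.diagonal_apply]
  conv_rhs => rw [← abs_of_pos hpi, ← abs_div, ← m0, ← Real.sqrt_sq_eq_abs]
  simp [sq]

theorem energyDensity_eq {x : Pt} (hx : x ∈ d.regularChart) :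
    energyDensity d.metric d.secondForm x
      = 2 * ((1 - deriv d.R (x 0) ^ 2 - 2 * d.R (x 0) * deriv (deriv d.R) (x 0)) / d.R (x 0) ^ 2
        - d.KR (x 0) ^ 2 - 2 * d.Kl (x 0) * d.KR (x 0)) / (8 * Real.pi) := by
  have h0 := hx.1
  rw [energyDensity, d.scal_metric hx, d.normSq_secondForm hx, d.trace_secondForm hx, trK]
  congr 1
  field_simp
  ring

theorem dominantEnergy_of_radial
    (h : ∀ ℓ, d.ℓ₀ ≤ ℓ →
      |d.H ℓ * (d.Kl ℓ - d.KR ℓ) - 2 * deriv d.KR ℓ|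
        ≤ (1 - deriv d.R ℓ ^ 2 - 2 * d.R ℓ * deriv (deriv d.R) ℓ) / d.R ℓ ^ 2
          - d.KR ℓ ^ 2 - 2 * d.Kl ℓ * d.KR ℓ) :
    d.DominantEnergy := by
  intro x hx
  have hx' := d.chart_subset_regularChart hx
  rw [d.momentumNorm_eq hx', d.energyDensity_eq hx', abs_mul, abs_two]
  have := h _ hx.1
  gcongr

theorem isMOTS_of_radial {ℓ : ℝ} (h : d.ℓ₀ ≤ ℓ) (hm : 2 * d.KR ℓ + d.H ℓ = 0) : d.IsMOTS ℓ := by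
  refine ⟨h, fun x hx hl => ?_⟩
  have hx' := d.chart_subset_regularChart hx
  rw [outerExpansion, d.tangentialTrace_secondForm hx', d.meanCurvature_metric hx', hl, hm]

theorem negativeInnerExpansion_of_radial (h : ∀ ℓ, d.ℓ₀ ≤ ℓ → 2 * d.KR ℓ - d.H ℓ < 0) :
    d.NegativeInnerExpansion := by
  intro x hx
  have hx' := d.chart_subset_regularChart hx
  rw [innerExpansion, d.tangentialTrace_secondForm hx', d.meanCurvature_metric hx']
  exact h _ hx.1

theorem sphereArea_eq (ℓ : ℝ) : d.sphereArea ℓ = 4 * Real.pi * d.R ℓ ^ 2 := by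
  have hdet : ∀ ϑ φ : ℝ, ((d.metric ![ℓ, ϑ, φ]).submatrix Fin.succ Fin.succ :
      Matrix (Fin 2) (Fin 2) ℝ).det = (d.R ℓ ^ 2 * Real.sin ϑ) ^ 2 := by
    intro ϑ φ
    simp [Matrix.det_fin_two, metric]
    ring
  have hint : ∀ ϑ ∈ Set.uIcc 0 Real.pi, (∫ _ in (0 : ℝ)..(2 * Real.pi),
      Real.sqrt ((d.R ℓ ^ 2 * Real.sin ϑ) ^ 2)) = 2 * Real.pi * d.R ℓ ^ 2 * Real.sin ϑ := by
    intro ϑ hϑ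
    rw [Set.uIcc_of_le Real.pi_pos.le] at hϑ
    rw [Real.sqrt_sq (mul_nonneg (sq_nonneg _) (Real.sin_nonneg_of_mem_Icc hϑ))]
    simp
    ring
  simp only [sphereArea, hdet]
  rw [intervalIntegral.integral_congr hint, intervalIntegral.integral_const_mul, integral_sin]
  simp
  ring

end SphericalData

/-! ### Data for which a prescribed function solves the Jang equation -/

theorem contDiff_deriv_of_contDiff_infty {f : ℝ → ℝ} (hf : ContDiff ℝ ∞ f) :
    ContDiff ℝ ∞ (deriv f) :=
  (contDiff_infty_iff_deriv.1 hf).2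

/-- The angular component `K_R` that makes `k` a solution of the Jang equation
`(R² k)' = R² (K_ℓ + 2 K_R - K_ℓ k²)` when `K_ℓ = 2q / R³`. On an interval where `k = 0` it
equals `-q / R³`, so that `K` is trace free and divergence free there. -/
noncomputable def jangKR (R k : ℝ → ℝ) (q ℓ : ℝ) : ℝ :=
  deriv R ℓ / R ℓ * k ℓ + deriv k ℓ / 2 - q / R ℓ ^ 3 * (1 - k ℓ ^ 2)

/-- Half of `8π (ρ - |μ|)` for the data with area radius `R`, `K_ℓ = 2q / R³` and `K_R = jangKR R k
q`. -/
noncomputable def energyMargin (R k : ℝ → ℝ) (q ℓ : ℝ) : ℝ :=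
  (1 - deriv R ℓ ^ 2 - 2 * R ℓ * deriv (deriv R) ℓ) / R ℓ ^ 2 - jangKR R k q ℓ ^ 2
    - 2 * (2 * q / R ℓ ^ 3) * jangKR R k q ℓ
    - |2 * deriv R ℓ / R ℓ * (2 * q / R ℓ ^ 3 - jangKR R k q ℓ) - 2 * deriv (jangKR R k q) ℓ|

theorem jangKR_congr {R R' k k' : ℝ → ℝ} {ℓ : ℝ} (hR : R =ᶠ[𝓝 ℓ] R') (hk : k =ᶠ[𝓝 ℓ] k') (q : ℝ) :
    jangKR R k q =ᶠ[𝓝 ℓ] jangKR R' k' q := by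
  filter_upwards [hR, hk, hR.deriv, hk.deriv] with t h1 h2 h3 h4
  simp only [jangKR, h1, h2, h3, h4]

theorem energyMargin_congr {R R' k k' : ℝ → ℝ} {ℓ : ℝ} (hR : R =ᶠ[𝓝 ℓ] R') (hk : k =ᶠ[𝓝 ℓ] k')
    (q : ℝ) : energyMargin R k q ℓ = energyMargin R' k' q ℓ := by
  have hK := jangKR_congr hR hk q
  rw [energyMargin, energyMargin, hR.eq_of_nhds, hR.deriv.eq_of_nhds, hR.deriv.deriv.eq_of_nhds,
    hK.eq_of_nhds, hK.deriv.eq_of_nhds]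

theorem contDiff_jangKR {R k : ℝ → ℝ} (hR : ContDiff ℝ ∞ R) (hk : ContDiff ℝ ∞ k)
    (h0 : ∀ ℓ, R ℓ ≠ 0) (q : ℝ) : ContDiff ℝ ∞ (jangKR R k q) := by
  have h1 := contDiff_deriv_of_contDiff_infty hR
  have h2 := contDiff_deriv_of_contDiff_infty hk
  exact (((h1.div hR h0).mul hk).add (h2.div_const 2)).sub
    ((contDiff_const.div (hR.pow 3) fun ℓ => pow_ne_zero 3 (h0 ℓ)).mul
      (contDiff_const.sub (hk.pow 2)))

namespace SphericalData

/-- The spherically symmetric data with area radius `R`, `K_ℓ = 2q / R³` and `K_R = jangKR R k q`,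
for which `k` solves the Jang equation. -/
noncomputable def ofJang (R k : ℝ → ℝ) (q ℓ₀ : ℝ) (hR : ContDiff ℝ ∞ R) (hk : ContDiff ℝ ∞ k)
    (hpos : ∀ ℓ, 0 < R ℓ) : SphericalData where
  ℓ₀ := ℓ₀
  R := R
  Kl := fun ℓ => 2 * q / R ℓ ^ 3
  KR := jangKR R k q
  smooth_R := hR
  smooth_Kl := contDiff_const.div (hR.pow 3) fun ℓ => pow_ne_zero 3 (hpos ℓ).ne'
  smooth_KR := contDiff_jangKR hR hk (fun ℓ => (hpos ℓ).ne') q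
  R_pos := fun ℓ _ => hpos ℓ

section ofJang

variable {R k : ℝ → ℝ} {q ℓ₀ : ℝ} {hR : ContDiff ℝ ∞ R} {hk : ContDiff ℝ ∞ k}
  {hpos : ∀ ℓ, 0 < R ℓ}

theorem ofJang_dominantEnergy (h : ∀ ℓ, ℓ₀ ≤ ℓ → 0 ≤ energyMargin R k q ℓ) :
    (ofJang R k q ℓ₀ hR hk hpos).DominantEnergy :=
  dominantEnergy_of_radial _ fun ℓ hℓ => sub_nonneg.1 (h ℓ hℓ)

theorem ofJang_negativeInnerExpansion
    (h : ∀ ℓ, ℓ₀ ≤ ℓ → jangKR R k q ℓ < deriv R ℓ / R ℓ) :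
    (ofJang R k q ℓ₀ hR hk hpos).NegativeInnerExpansion := by
  refine negativeInnerExpansion_of_radial _ fun ℓ hℓ => ?_
  have h1 : 2 * jangKR R k q ℓ - 2 * deriv R ℓ / R ℓ < 0 := by
    rw [mul_div_assoc]
    linarith [h ℓ hℓ]
  exact h1

theorem ofJang_isMOTS {ℓ : ℝ} (hℓ : ℓ₀ ≤ ℓ) (h : jangKR R k q ℓ = -(deriv R ℓ / R ℓ)) :
    (ofJang R k q ℓ₀ hR hk hpos).IsMOTS ℓ := by
  refine isMOTS_of_radial _ hℓ ?_
  have h1 : 2 * jangKR R k q ℓ + 2 * deriv R ℓ / R ℓ = 0 := by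
    rw [mul_div_assoc, h]
    ring
  exact h1

theorem ofJang_nonzeroK (hq : q ≠ 0) : (ofJang R k q ℓ₀ hR hk hpos).NonzeroK := by
  refine ⟨![ℓ₀, Real.pi / 2, 0], ⟨le_rfl, by simp [Real.pi_pos], by simp [Real.pi_pos]⟩,
    fun h => ?_⟩
  have h0 := congrFun (congrFun h 0) 0
  simp [secondForm, ofJang, hq, (hpos ℓ₀).ne'] at h0

theorem ofJang_solvesJang (s : ℝ) : (ofJang R k q ℓ₀ hR hk hpos).SolvesJang s k := by
  intro ℓ hℓ
  have h1 := (hR.differentiable (by simp) ℓ).hasDerivAt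
  have h2 := (hk.differentiable (by simp) ℓ).hasDerivAt
  have h3 := (h1.fun_pow 2).fun_mul h2
  have h0 := (hpos ℓ).ne'
  change derivWithin (fun t => R t ^ 2 * k t) (Set.Ici s) ℓ
    - R ℓ ^ 2 * (2 * q / R ℓ ^ 3 + 2 * jangKR R k q ℓ - 2 * q / R ℓ ^ 3 * k ℓ ^ 2) = 0
  rw [h3.differentiableAt.derivWithin (uniqueDiffOn_Ici s ℓ hℓ), h3.deriv, jangKR]
  field_simp
  ring

end ofJang

/-- The decay conditions hold if, near infinity, the metric is flat and `K` is the trace-free tensor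
with `K_ℓ = 2q / R³` and `K_R = -q / R³`. -/
theorem decay_of_tail (d : SphericalData) (m q ℓ' : ℝ)
    (hR : ∀ ℓ, ℓ' < ℓ → d.R ℓ = ℓ + m) (hKl : ∀ ℓ, ℓ' < ℓ → d.Kl ℓ = 2 * q / (ℓ + m) ^ 3)
    (hKR : ∀ ℓ, ℓ' < ℓ → d.KR ℓ = -(q / (ℓ + m) ^ 3)) : d.Decay := by
  have hr : (fun ℓ : ℝ => (ℓ + m)⁻¹) =O[atTop] fun ℓ : ℝ => ℓ⁻¹ := by
    refine Asymptotics.IsBigO.of_bound 2 ?_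
    filter_upwards [eventually_gt_atTop (0 : ℝ), eventually_ge_atTop (2 * |m|)] with ℓ h1 h2
    have h3 : ℓ / 2 ≤ ℓ + m := by linarith [neg_abs_le m]
    rw [Real.norm_of_nonneg (inv_nonneg.2 (by linarith)), Real.norm_of_nonneg (inv_nonneg.2 h1.le)]
    calc (ℓ + m)⁻¹ ≤ (ℓ / 2)⁻¹ := inv_anti₀ (by linarith) h3
      _ = 2 * ℓ⁻¹ := by rw [inv_div]; rfl
  have hone : (fun ℓ : ℝ => ℓ⁻¹) =O[atTop] fun _ : ℝ => (1 : ℝ) :=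
    tendsto_inv_atTop_zero.isBigO_one ℝ
  have hr1 := hr.trans hone
  have hderiv : ∀ {f g : ℝ → ℝ}, (∀ ℓ, ℓ' < ℓ → f ℓ = g ℓ) → ∀ ℓ, ℓ' < ℓ → deriv f ℓ = deriv g ℓ :=
    fun h ℓ hℓ => EventuallyEq.deriv_eq (by
      filter_upwards [Ioi_mem_nhds hℓ] with t ht using h t ht)
  have hdR : ∀ ℓ, ℓ' < ℓ → deriv d.R ℓ = 1 := fun ℓ hℓ => by
    rw [hderiv hR ℓ hℓ]; simp
  have hH : ∀ ℓ, ℓ' < ℓ → d.H ℓ = 2 * (ℓ + m)⁻¹ := fun ℓ hℓ => by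
    rw [H, hdR ℓ hℓ, hR ℓ hℓ]; ring
  have hlarge : ∀ᶠ ℓ : ℝ in atTop, ℓ' < ℓ ∧ 0 < ℓ ∧ 0 < ℓ + m := by
    filter_upwards [eventually_gt_atTop ℓ', eventually_gt_atTop (0 : ℝ),
      eventually_gt_atTop (-m)] with ℓ h1 h2 h3 using ⟨h1, h2, by linarith⟩
  have hdinv : ∀ ℓ, 0 < ℓ + m → HasDerivAt (fun ℓ : ℝ => (ℓ + m)⁻¹) (-(ℓ + m)⁻¹ ^ 2) ℓ :=
    fun ℓ hℓ => by
      have := ((hasDerivAt_id ℓ).add_const m).fun_inv hℓ.ne'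
      simpa [div_eq_mul_inv] using this
  have hdinv3 : ∀ ℓ, 0 < ℓ + m →
      HasDerivAt (fun ℓ : ℝ => (ℓ + m)⁻¹ ^ 3) (-3 * (ℓ + m)⁻¹ ^ 4) ℓ := fun ℓ hℓ => by
    refine ((hdinv ℓ hℓ).fun_pow 3).congr_deriv ?_
    push_cast
    ring
  have h2 : (fun ℓ : ℝ => ℓ⁻¹ * ℓ⁻¹) = fun ℓ : ℝ => (ℓ ^ 2)⁻¹ := by
    ext ℓ; rw [← mul_inv, sq]
  have h3 : (fun ℓ : ℝ => (ℓ⁻¹) ^ 3) = fun ℓ : ℝ => (ℓ ^ 3)⁻¹ := by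
    ext ℓ; rw [inv_pow]
  have hr2 : (fun ℓ : ℝ => (ℓ + m)⁻¹ ^ 3) =O[atTop] fun ℓ : ℝ => (ℓ ^ 2)⁻¹ := by
    rw [← h2]
    refine ((hr.mul hr).mul hr1).congr (fun ℓ => ?_) (fun ℓ => ?_) <;> ring
  have hr3 : (fun ℓ : ℝ => (ℓ + m)⁻¹ ^ 4) =O[atTop] fun ℓ : ℝ => (ℓ ^ 3)⁻¹ := by
    rw [← h3]
    refine ((hr.pow 3).mul hr1).congr (fun ℓ => ?_) (fun ℓ => ?_) <;> ring
  refine ⟨?_, ?_, ?_, ?_, ?_, ?_, ?_, ?_⟩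
  · have : (fun ℓ : ℝ => (2 * m + m ^ 2 * ℓ⁻¹) * ℓ⁻¹) =O[atTop] fun ℓ : ℝ => ℓ⁻¹ := by
      have h1 := ((Asymptotics.isBigO_refl (fun _ : ℝ => (1 : ℝ)) atTop).const_mul_left (2 * m)).add
        (hone.const_mul_left (m ^ 2))
      refine (h1.mul (Asymptotics.isBigO_refl (fun ℓ : ℝ => ℓ⁻¹) atTop)).congr
        (fun ℓ => ?_) (fun ℓ => ?_) <;> ring
    refine this.congr' ?_ .rfl
    filter_upwards [hlarge] with ℓ ⟨h, hℓ, _⟩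
    rw [hR ℓ h]
    field_simp
    ring
  · rw [← h2]
    refine ((hr.mul (Asymptotics.isBigO_refl (fun ℓ : ℝ => ℓ⁻¹) atTop)).const_mul_left
      (-(2 * m))).congr' ?_ .rfl
    filter_upwards [hlarge] with ℓ ⟨h, hℓ, hm⟩
    rw [hH ℓ h]
    field_simp
    ring
  · rw [← h3]
    have h1 := hr.add (Asymptotics.isBigO_refl (fun ℓ : ℝ => ℓ⁻¹) atTop)
    refine (((hr.mul (Asymptotics.isBigO_refl (fun ℓ : ℝ => ℓ⁻¹) atTop)).mul h1).const_mul_left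
      (2 * m)).congr' ?_ (.of_eq (by ext; ring))
    filter_upwards [hlarge] with ℓ ⟨h, hℓ, hm⟩
    rw [hderiv hH ℓ h, ((hdinv ℓ hm).const_mul 2).deriv]
    field_simp
    ring
  · refine (hr2.const_mul_left (2 * q)).congr' ?_ .rfl
    filter_upwards [hlarge] with ℓ ⟨h, _, _⟩
    rw [hKl ℓ h, inv_pow, div_eq_mul_inv]
  · refine (hr2.const_mul_left (-q)).congr' ?_ .rfl
    filter_upwards [hlarge] with ℓ ⟨h, _, _⟩
    rw [hKR ℓ h, inv_pow, div_eq_mul_inv, neg_mul]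
  · refine (hr3.const_mul_left (-6 * q)).congr' ?_ .rfl
    filter_upwards [hlarge] with ℓ ⟨h, _, hm⟩
    have : ∀ ℓ, ℓ' < ℓ → d.Kl ℓ = 2 * q * (ℓ + m)⁻¹ ^ 3 := fun ℓ h => by
      rw [hKl ℓ h, inv_pow, div_eq_mul_inv]
    rw [hderiv this ℓ h, ((hdinv3 ℓ hm).const_mul (2 * q)).deriv]
    ring
  · refine (hr3.const_mul_left (3 * q)).congr' ?_ .rfl
    filter_upwards [hlarge] with ℓ ⟨h, _, hm⟩
    have : ∀ ℓ, ℓ' < ℓ → d.KR ℓ = -q * (ℓ + m)⁻¹ ^ 3 := fun ℓ h => by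
      rw [hKR ℓ h, inv_pow, div_eq_mul_inv, neg_mul]
    rw [hderiv this ℓ h, ((hdinv3 ℓ hm).const_mul (-q)).deriv]
    ring
  · refine (Asymptotics.isBigO_zero _ atTop).congr' ?_ .rfl
    filter_upwards [hlarge] with ℓ ⟨h, _, _⟩
    rw [trK, hKl ℓ h, hKR ℓ h]
    ring

end SphericalData

/-! ### Slowly varying profiles -/

theorem deriv_comp_mul_left_eq (f : ℝ → ℝ) (ε : ℝ) :
    deriv (fun t => f (ε * t)) = fun t => ε * deriv f (ε * t) :=
  funext fun t => deriv_comp_mul_left ε f t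

theorem jangKR_scale (ρ κ : ℝ → ℝ) (q ε : ℝ) :
    jangKR (fun t => ρ (ε * t)) (fun t => κ (ε * t)) q
      = fun t => ε * jangKR ρ κ 0 (ε * t) - q / ρ (ε * t) ^ 3 * (1 - κ (ε * t) ^ 2) := by
  ext t
  simp only [jangKR, deriv_comp_mul_left_eq]
  ring

/-- Slowly varying data satisfy the dominant energy condition strictly. With `p = q / ρ³` and `m = 1
- κ²`, the limit of the margin as `ε → 0` is `1 / ρ² + p² m (4 - m) > 0`, because the signs in the
energy density make the term `-2 K_ℓ K_R → 4 p² m` a gain; the remaining terms depend continuously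
on `(ε, τ)`. -/
theorem eventually_energyMargin_scale_pos {ρ κ : ℝ → ℝ} (hρ : ContDiff ℝ ∞ ρ)
    (hκ : ContDiff ℝ ∞ κ) (hpos : ∀ τ, 0 < ρ τ) {I : Set ℝ} (hI : IsCompact I)
    (hκ1 : ∀ τ ∈ I, κ τ ^ 2 ≤ 1) (q : ℝ) :
    ∀ᶠ ε in 𝓝 (0 : ℝ), ∀ τ ∈ I, ∀ ℓ, ε * ℓ = τ →
      0 < energyMargin (fun t => ρ (ε * t)) (fun t => κ (ε * t)) q ℓ := by
  have hne : ∀ τ, ρ τ ≠ 0 := fun τ => (hpos τ).ne'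
  have ha := contDiff_jangKR hρ hκ hne 0
  have hb : ContDiff ℝ ∞ fun τ => q / ρ τ ^ 3 * (1 - κ τ ^ 2) :=
    (contDiff_const.div (hρ.pow 3) fun τ => pow_ne_zero 3 (hne τ)).mul
      (contDiff_const.sub (hκ.pow 2))
  set a := jangKR ρ κ 0 with ha_def
  set b := fun τ => q / ρ τ ^ 3 * (1 - κ τ ^ 2) with hb_def
  have hρ' := contDiff_deriv_of_contDiff_infty hρ
  have c0 := hρ.continuous
  have c1 := hρ'.continuous
  have c2 := (contDiff_deriv_of_contDiff_infty hρ').continuous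
  have c3 := ha.continuous
  have c4 := hb.continuous
  have c5 := (contDiff_deriv_of_contDiff_infty ha).continuous
  have c6 := (contDiff_deriv_of_contDiff_infty hb).continuous
  let F : ℝ × ℝ → ℝ := fun z =>
    (1 - (z.1 * deriv ρ z.2) ^ 2 - 2 * ρ z.2 * (z.1 * (z.1 * deriv (deriv ρ) z.2))) / ρ z.2 ^ 2
      - (z.1 * a z.2 - b z.2) ^ 2 - 2 * (2 * q / ρ z.2 ^ 3) * (z.1 * a z.2 - b z.2)
      - |2 * (z.1 * deriv ρ z.2) / ρ z.2 * (2 * q / ρ z.2 ^ 3 - (z.1 * a z.2 - b z.2))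
        - 2 * (z.1 * (z.1 * deriv a z.2 - deriv b z.2))|
  have hF : Continuous F := by
    have d2 : ∀ z : ℝ × ℝ, ρ z.2 ^ 2 ≠ 0 := fun z => pow_ne_zero 2 (hne _)
    have d3 : ∀ z : ℝ × ℝ, ρ z.2 ^ 3 ≠ 0 := fun z => pow_ne_zero 3 (hne _)
    have d1 : ∀ z : ℝ × ℝ, ρ z.2 ≠ 0 := fun z => hne _
    fun_prop (disch := assumption)
  have hscale : ∀ ε ℓ, energyMargin (fun t => ρ (ε * t)) (fun t => κ (ε * t)) q ℓ
      = F (ε, ε * ℓ) := by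
    intro ε ℓ
    have hd : deriv (fun t => ε * a (ε * t) - b (ε * t)) ℓ
        = ε * (ε * deriv a (ε * ℓ) - deriv b (ε * ℓ)) := by
      have h1 := (ha.differentiable (by simp) (ε * ℓ)).hasDerivAt.comp ℓ
        ((hasDerivAt_id ℓ).const_mul ε)
      have h2 := (hb.differentiable (by simp) (ε * ℓ)).hasDerivAt.comp ℓ
        ((hasDerivAt_id ℓ).const_mul ε)
      refine ((h1.const_mul ε).sub h2).deriv.trans ?_
      ring
    have hdd : deriv (fun t => ε * deriv ρ (ε * t)) ℓ = ε * (ε * deriv (deriv ρ) (ε * ℓ)) := by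
      rw [deriv_const_mul_field, deriv_comp_mul_left_eq]
    have hK : jangKR (fun t => ρ (ε * t)) (fun t => κ (ε * t)) q
        = fun t => ε * a (ε * t) - b (ε * t) := jangKR_scale ρ κ q ε
    simp only [energyMargin, hK, hd, deriv_comp_mul_left_eq ρ, hdd, F]
  have hF0 : ∀ τ ∈ I, 0 < F (0, τ) := by
    intro τ hτ
    have h1 : F (0, τ) = 1 / ρ τ ^ 2
        + (q / ρ τ ^ 3) ^ 2 * ((1 - κ τ ^ 2) * (4 - (1 - κ τ ^ 2))) := by
      simp only [F, hb_def]
      simp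
      ring
    rw [h1]
    have h2 : 0 ≤ (1 - κ τ ^ 2) * (4 - (1 - κ τ ^ 2)) :=
      mul_nonneg (by linarith [hκ1 τ hτ]) (by linarith [sq_nonneg (κ τ)])
    have h3 : 0 < 1 / ρ τ ^ 2 := by
      have := hpos τ
      positivity
    positivity
  have := hI.eventually_forall_of_forall_eventually (x₀ := (0 : ℝ))
    (P := fun ε τ => 0 < F (ε, τ))
    fun τ hτ => hF.continuousAt.eventually (lt_mem_nhds (hF0 τ hτ))
  filter_upwards [this] with ε hε τ hτ ℓ hℓ
  rw [hscale, hℓ]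
  exact hε τ hτ

/-- The inequality `θ⁻ < 0` for slowly varying data, away from `κ = ±1`: in the limit `ε → 0` it
reads `-(1 - κ²) q / ρ³ < 0`. -/
theorem eventually_jangKR_scale_lt {ρ κ : ℝ → ℝ} (hρ : ContDiff ℝ ∞ ρ)
    (hκ : ContDiff ℝ ∞ κ) (hpos : ∀ τ, 0 < ρ τ) {I : Set ℝ} (hI : IsCompact I)
    (hκ1 : ∀ τ ∈ I, κ τ ^ 2 < 1) {q : ℝ} (hq : 0 < q) :
    ∀ᶠ ε in 𝓝 (0 : ℝ), ∀ τ ∈ I, ∀ ℓ, ε * ℓ = τ →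
      jangKR (fun t => ρ (ε * t)) (fun t => κ (ε * t)) q ℓ
        < deriv (fun t => ρ (ε * t)) ℓ / ρ (ε * ℓ) := by
  have hne : ∀ τ, ρ τ ≠ 0 := fun τ => (hpos τ).ne'
  have c0 := hρ.continuous
  have c1 := (contDiff_deriv_of_contDiff_infty hρ).continuous
  have c2 := (contDiff_jangKR hρ hκ hne 0).continuous
  have c3 := hκ.continuous
  let F : ℝ × ℝ → ℝ := fun z => z.1 * deriv ρ z.2 / ρ z.2
    - (z.1 * jangKR ρ κ 0 z.2 - q / ρ z.2 ^ 3 * (1 - κ z.2 ^ 2))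
  have hF : Continuous F := by
    have d1 : ∀ z : ℝ × ℝ, ρ z.2 ≠ 0 := fun z => hne _
    have d3 : ∀ z : ℝ × ℝ, ρ z.2 ^ 3 ≠ 0 := fun z => pow_ne_zero 3 (hne _)
    fun_prop (disch := assumption)
  have hF0 : ∀ τ ∈ I, 0 < F (0, τ) := by
    intro τ hτ
    have h1 := hpos τ
    have h2 : 0 < 1 - κ τ ^ 2 := sub_pos.2 (hκ1 τ hτ)
    simp only [F, zero_mul, zero_div, zero_sub, neg_neg]
    positivity
  have := hI.eventually_forall_of_forall_eventually (x₀ := (0 : ℝ))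
    (P := fun ε τ => 0 < F (ε, τ))
    fun τ hτ => hF.continuousAt.eventually (lt_mem_nhds (hF0 τ hτ))
  filter_upwards [this] with ε hε τ hτ ℓ hℓ
  rw [jangKR_scale, deriv_comp_mul_left_eq]
  simp only [hℓ]
  exact sub_pos.1 (hε τ hτ)

/-- If `k` vanishes identically, the momentum density vanishes, and the margin is half the scalar
curvature plus a nonnegative term that grows with `q`. -/
theorem energyMargin_of_zero {R : ℝ → ℝ} {ℓ : ℝ} (hR : DifferentiableAt ℝ R ℓ) (h0 : R ℓ ≠ 0)
    (q : ℝ) : energyMargin R (fun _ => 0) q ℓ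
      = (1 - deriv R ℓ ^ 2 - 2 * R ℓ * deriv (deriv R) ℓ) / R ℓ ^ 2 + 3 * q ^ 2 / R ℓ ^ 6 := by
  have hK : jangKR R (fun _ => 0) q = fun t => -(q / R t ^ 3) := by
    ext t
    simp [jangKR]
  have hd : deriv (fun t => -(q / R t ^ 3)) ℓ = 3 * q * deriv R ℓ / R ℓ ^ 4 := by
    have h1 := hR.hasDerivAt.fun_pow 3
    have h2 := (((hasDerivAt_const ℓ q).fun_div h1 (pow_ne_zero 3 h0)).fun_neg).deriv
    rw [h2]
    push_cast
    field_simp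
    ring
  have habs : 2 * deriv R ℓ / R ℓ * (2 * q / R ℓ ^ 3 - -(q / R ℓ ^ 3))
      - 2 * (3 * q * deriv R ℓ / R ℓ ^ 4) = 0 := by
    field_simp
    ring
  rw [energyMargin, hK, hd]
  simp only [habs, abs_zero]
  field_simp
  ring

/-! ### The flat exterior -/

/-- A smooth nondecreasing function that is `0` for `x ≤ 0` and the identity for `1 ≤ x`; the radius
`1 + flare` passes from a cylinder to flat space. -/
noncomputable def flare (x : ℝ) : ℝ := x * Real.smoothTransition x

theorem contDiff_flare : ContDiff ℝ ∞ flare := contDiff_id.mul Real.smoothTransition.contDiff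

theorem flare_of_nonpos {x : ℝ} (hx : x ≤ 0) : flare x = 0 := by
  rw [flare, Real.smoothTransition.zero_of_nonpos hx, mul_zero]

theorem flare_of_one_le {x : ℝ} (hx : 1 ≤ x) : flare x = x := by
  rw [flare, Real.smoothTransition.one_of_one_le hx, mul_one]

theorem flare_nonneg (x : ℝ) : 0 ≤ flare x := by
  rcases le_total x 0 with hx | hx
  · exact (flare_of_nonpos hx).ge
  · exact mul_nonneg hx (Real.smoothTransition.nonneg x)

theorem monotone_flare : Monotone flare := by
  intro x y hxy
  rcases le_total x 0 with hx | hx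
  · exact (flare_of_nonpos hx).trans_le (flare_nonneg y)
  · exact mul_le_mul hxy (Real.smoothTransition.monotone hxy) (Real.smoothTransition.nonneg x)
      (hx.trans hxy)

/-- The scalar curvature of the radius `1 + flare` is negative at most on the compact set `0 ≤ x ≤
1`, so a large `q = Q²` compensates for it. -/
theorem exists_forall_flare_energy :
    ∃ Q₀ : ℝ, ∀ Q, Q₀ ≤ Q → ∀ x,
      0 ≤ energyMargin (fun t => 1 + flare t) (fun _ => 0) (Q ^ 2) x := by
  have hs := contDiff_flare
  have h1 := contDiff_deriv_of_contDiff_infty hs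
  have c0 := hs.continuous
  have c1 := h1.continuous
  have c2 := (contDiff_deriv_of_contDiff_infty h1).continuous
  obtain ⟨B, hB⟩ := (isCompact_Icc (a := (0 : ℝ)) (b := 1)).bddBelow_image
    (f := fun x => (1 - deriv flare x ^ 2 - 2 * (1 + flare x) * deriv (deriv flare) x)
      * (1 + flare x) ^ 4) (by fun_prop)
  refine ⟨max 1 (-B), fun Q hQ x => ?_⟩
  have hQ1 : 1 ≤ Q := (le_max_left _ _).trans hQ
  have hQB : -B ≤ Q := (le_max_right _ _).trans hQ
  have hp : 0 < 1 + flare x := by linarith [flare_nonneg x]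
  have hQ4 : Q ≤ (Q ^ 2) ^ 2 := by
    rw [← pow_mul]
    exact le_self_pow₀ hQ1 (by norm_num)
  have hd : deriv (fun t => 1 + flare t) = deriv flare := by
    ext t
    simp
  rw [energyMargin_of_zero ((hs.differentiable (by simp) x).const_add 1) hp.ne', hd]
  suffices h : 0 ≤ (1 - deriv flare x ^ 2 - 2 * (1 + flare x) * deriv (deriv flare) x)
      * (1 + flare x) ^ 4 + 3 * (Q ^ 2) ^ 2 by
    refine (div_nonneg h (pow_pos hp 6).le).trans_eq ?_
    field_simp
  rcases lt_or_ge x 0 with hx | hx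
  · have he : flare =ᶠ[𝓝 x] fun _ => 0 := by
      filter_upwards [Iio_mem_nhds hx] with t ht using flare_of_nonpos (le_of_lt ht)
    rw [he.deriv.eq_of_nhds, he.deriv.deriv.eq_of_nhds]
    simp
    positivity
  rcases lt_or_ge 1 x with hx1 | hx1
  · have he : flare =ᶠ[𝓝 x] fun t => t := by
      filter_upwards [Ioi_mem_nhds hx1] with t ht using flare_of_one_le (le_of_lt ht)
    rw [he.deriv.eq_of_nhds, he.deriv.deriv.eq_of_nhds]
    simp
    positivity
  · linarith [hB (Set.mem_image_of_mem _ ⟨hx, hx1⟩)]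

theorem energyMargin_comp_sub (R : ℝ → ℝ) (q s ℓ : ℝ) :
    energyMargin (fun t => R (t - s)) (fun _ => 0) q ℓ = energyMargin R (fun _ => 0) q (ℓ - s) := by
  have h1 : ∀ f : ℝ → ℝ, deriv (fun t => f (t - s)) = fun t => deriv f (t - s) :=
    fun f => funext fun t => deriv_comp_sub_const f s t
  have hK : jangKR (fun t => R (t - s)) (fun _ => 0) q
      = fun t => jangKR R (fun _ => 0) q (t - s) := by
    ext t
    simp [jangKR]
  simp only [energyMargin, hK, h1]

/-! ### The profiles of the blow-up solution and of the area radius -/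

/-- The blow-up solution in slow time `τ = ε ℓ`: it is `-1` for `τ ≤ 0` and `0` for `1 ≤ τ`. -/
noncomputable def blowUpProfile (τ : ℝ) : ℝ := -1 + Real.smoothTransition τ

/-- The area radius of the inner region in slow time `τ = ε ℓ`: it grows exponentially for `τ ≤ 2`
and then returns to the constant `1`, which it equals for `3 ≤ τ`. -/
noncomputable def radiusProfile (c A τ : ℝ) : ℝ :=
  1 + A * Real.exp (c * τ) * Real.smoothTransition (3 - τ)

theorem contDiff_blowUpProfile : ContDiff ℝ ∞ blowUpProfile :=
  contDiff_const.add Real.smoothTransition.contDiff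

theorem contDiff_radiusProfile (c A : ℝ) : ContDiff ℝ ∞ (radiusProfile c A) :=
  contDiff_const.add
    ((contDiff_const.mul (Real.contDiff_exp.comp (contDiff_const.mul contDiff_id))).mul
      (Real.smoothTransition.contDiff.comp (contDiff_const.sub contDiff_id)))

theorem one_le_radiusProfile {A : ℝ} (hA : 0 ≤ A) (c τ : ℝ) : 1 ≤ radiusProfile c A τ := by
  have := Real.smoothTransition.nonneg (3 - τ)
  have : 0 ≤ A * Real.exp (c * τ) * Real.smoothTransition (3 - τ) := by positivity
  rw [radiusProfile]
  linarith

theorem radiusProfile_of_le_two (c A : ℝ) {τ : ℝ} (hτ : τ ≤ 2) :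
    radiusProfile c A τ = 1 + A * Real.exp (c * τ) := by
  rw [radiusProfile, Real.smoothTransition.one_of_one_le (by linarith), mul_one]

theorem radiusProfile_of_three_le (c A : ℝ) {τ : ℝ} (hτ : 3 ≤ τ) : radiusProfile c A τ = 1 := by
  rw [radiusProfile, Real.smoothTransition.zero_of_nonpos (by linarith), mul_zero, add_zero]

theorem blowUpProfile_of_one_le {τ : ℝ} (hτ : 1 ≤ τ) : blowUpProfile τ = 0 := by
  rw [blowUpProfile, Real.smoothTransition.one_of_one_le hτ, neg_add_cancel]

theorem neg_one_le_blowUpProfile (τ : ℝ) : -1 ≤ blowUpProfile τ := by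
  rw [blowUpProfile]
  linarith [Real.smoothTransition.nonneg τ]

theorem blowUpProfile_nonpos (τ : ℝ) : blowUpProfile τ ≤ 0 := by
  rw [blowUpProfile]
  linarith [Real.smoothTransition.le_one τ]

theorem deriv_blowUpProfile_zero : deriv blowUpProfile 0 = 0 := by
  refine IsLocalMin.deriv_eq_zero (Eventually.of_forall fun τ => ?_)
  refine (Eq.le ?_).trans (neg_one_le_blowUpProfile τ)
  rw [blowUpProfile, Real.smoothTransition.zero, add_zero]

theorem deriv_radiusProfile_of_lt_two (c A : ℝ) {τ : ℝ} (hτ : τ < 2) :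
    deriv (radiusProfile c A) τ = c * (A * Real.exp (c * τ)) := by
  have he : radiusProfile c A =ᶠ[𝓝 τ] fun t => 1 + A * Real.exp (c * t) := by
    filter_upwards [Iio_mem_nhds hτ] with t ht using radiusProfile_of_le_two c A (le_of_lt ht)
  have h1 := (((hasDerivAt_id τ).const_mul c).exp.const_mul A).const_add 1
  rw [he.deriv_eq]
  refine h1.deriv.trans ?_
  simp
  ring

/-- While `1 ≤ A exp (c τ)`, the logarithmic derivative of `1 + A exp (c τ)` is at least `c / 2`. -/
theorem half_le_logDeriv_radiusProfile {c A τ : ℝ} (hc : 0 ≤ c) (hA : Real.exp c ≤ A)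
    (hτ : τ ∈ Set.Icc (-1 : ℝ) 1) :
    c / 2 ≤ deriv (radiusProfile c A) τ / radiusProfile c A τ := by
  rw [deriv_radiusProfile_of_lt_two c A (by linarith [hτ.2]),
    radiusProfile_of_le_two c A (by linarith [hτ.2])]
  have h1 : 1 ≤ A * Real.exp (c * τ) := by
    calc 1 ≤ Real.exp (c + c * τ) := Real.one_le_exp (by nlinarith [hτ.1])
      _ = Real.exp c * Real.exp (c * τ) := Real.exp_add _ _
      _ ≤ A * Real.exp (c * τ) := by gcongr
  rw [le_div_iff₀ (by linarith)]
  nlinarith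

theorem exists_deriv_blowUpProfile_lt :
    ∃ c : ℝ, 0 ≤ c ∧ ∀ τ ∈ Set.Icc (-1 : ℝ) 1, deriv blowUpProfile τ < c := by
  have h := (contDiff_deriv_of_contDiff_infty contDiff_blowUpProfile).continuous
  obtain ⟨B, hB⟩ := (isCompact_Icc (a := (-1 : ℝ)) (b := 1)).bddAbove_image h.continuousOn
  refine ⟨max 0 (B + 1), le_max_left _ _, fun τ hτ => ?_⟩
  have := hB (Set.mem_image_of_mem _ hτ)
  exact lt_of_lt_of_le (by linarith) (le_max_right 0 (B + 1))

/-- The area radius of the data: the slow profile in the inner region and, from `ℓ = 4 / ε` on, the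
passage from a cylinder of radius `1` to flat space. The two parts overlap where the radius is
constant. -/
noncomputable def gluedRadius (c A ε ℓ : ℝ) : ℝ :=
  radiusProfile c A (ε * ℓ) + flare (ℓ - 4 / ε)

theorem contDiff_gluedRadius (c A ε : ℝ) : ContDiff ℝ ∞ (gluedRadius c A ε) :=
  ((contDiff_radiusProfile c A).comp (contDiff_const.mul contDiff_id)).add
    (contDiff_flare.comp (contDiff_id.sub contDiff_const))

theorem gluedRadius_pos {A : ℝ} (hA : 0 ≤ A) (c ε ℓ : ℝ) : 0 < gluedRadius c A ε ℓ := by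
  have h1 := one_le_radiusProfile hA c (ε * ℓ)
  have h2 := flare_nonneg (ℓ - 4 / ε)
  rw [gluedRadius]
  linarith

theorem gluedRadius_eventuallyEq_radiusProfile (c A : ℝ) {ε ℓ : ℝ} (hε : 0 < ε)
    (hℓ : ε * ℓ < 4) : gluedRadius c A ε =ᶠ[𝓝 ℓ] fun t => radiusProfile c A (ε * t) := by
  have hℓ' : ℓ < 4 / ε := by rwa [lt_div_iff₀' hε]
  filter_upwards [Iio_mem_nhds hℓ'] with t ht
  rw [gluedRadius, flare_of_nonpos (sub_nonpos.2 (le_of_lt ht)), add_zero]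

theorem gluedRadius_eventuallyEq_flare (c A : ℝ) {ε ℓ : ℝ} (hε : 0 < ε) (hℓ : 3 < ε * ℓ) :
    gluedRadius c A ε =ᶠ[𝓝 ℓ] fun t => 1 + flare (t - 4 / ε) := by
  have hℓ' : 3 / ε < ℓ := by rwa [div_lt_iff₀' hε]
  filter_upwards [Ioi_mem_nhds hℓ'] with t ht
  rw [gluedRadius, radiusProfile_of_three_le c A ((div_lt_iff₀' hε).1 ht).le]

theorem blowUpProfile_scale_eventuallyEq_zero {ε ℓ : ℝ} (hε : 0 < ε) (hℓ : 1 < ε * ℓ) :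
    (fun t => blowUpProfile (ε * t)) =ᶠ[𝓝 ℓ] fun _ => 0 := by
  have hℓ' : 1 / ε < ℓ := by rwa [div_lt_iff₀' hε]
  filter_upwards [Ioi_mem_nhds hℓ'] with t ht
  exact blowUpProfile_of_one_le ((div_lt_iff₀' hε).1 ht).le

/-- The inequality `θ⁻ < 0` near the blow-up sphere, where `1 - κ²` gives no uniform bound: it holds
for every `ε` if the radius grows fast compared with `κ`. -/
theorem jangKR_scale_lt_of_logDeriv {ρ κ : ℝ → ℝ} {q ε ℓ : ℝ} (hε : 0 < ε) (hq : 0 ≤ q)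
    (hρ : 0 < ρ (ε * ℓ)) (h1 : -1 ≤ κ (ε * ℓ)) (h0 : κ (ε * ℓ) ≤ 0)
    (h : deriv κ (ε * ℓ) / 2 < deriv ρ (ε * ℓ) / ρ (ε * ℓ))
    (h' : 0 ≤ deriv ρ (ε * ℓ) / ρ (ε * ℓ)) :
    jangKR (fun t => ρ (ε * t)) (fun t => κ (ε * t)) q ℓ
      < deriv (fun t => ρ (ε * t)) ℓ / ρ (ε * ℓ) := by
  rw [jangKR_scale, deriv_comp_mul_left_eq]
  simp only [jangKR, zero_div, zero_mul, sub_zero, mul_div_assoc]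
  have h2 : 0 ≤ q / ρ (ε * ℓ) ^ 3 * (1 - κ (ε * ℓ) ^ 2) :=
    mul_nonneg (by positivity) (by nlinarith)
  have h3 : deriv ρ (ε * ℓ) / ρ (ε * ℓ) * κ (ε * ℓ) ≤ 0 := mul_nonpos_of_nonneg_of_nonpos h' h0
  nlinarith

/-! ### The counterexample -/

theorem proposition4 :
    ∃ d : SphericalData,
      d.NonzeroK ∧ d.DominantEnergy ∧ d.Decay ∧
      (d.NegativeInnerExpansion ∨ d.NegativeTrace) ∧
      ∃ ℓ₁ ℓ₂ : ℝ, d.ℓ₀ < ℓ₁ ∧ ℓ₁ < ℓ₂ ∧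
        d.IsMOTS ℓ₁ ∧ d.IsMOTS ℓ₂ ∧
        d.R ℓ₂ < d.R ℓ₁ ∧ d.sphereArea ℓ₂ < d.sphereArea ℓ₁ ∧
        ∃ k : ℝ → ℝ, d.IsBlowUpSolution ℓ₁ k := by
  obtain ⟨c, hc, hcκ⟩ := exists_deriv_blowUpProfile_lt
  obtain ⟨Q₀, hQ₀⟩ := exists_forall_flare_energy
  -- `2 < Q` ensures that the sphere of radius `Q` lies where the metric is flat.
  set Q := max 3 Q₀
  have hQ3 : 3 ≤ Q := le_max_left _ _
  have hflare := hQ₀ Q (le_max_right _ _)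
  have hq : 0 < Q ^ 2 := by positivity
  -- `Q` makes the inner MOTS, of radius `1 + A`, larger than the outer one; `exp c` is the bound
  -- that the growth estimate needs down to `τ = -1`.
  set A := Q + Real.exp c with hA_def
  have hA0 : 0 ≤ A := by positivity
  have hAc : Real.exp c ≤ A := by linarith
  have hρpos : ∀ τ, 0 < radiusProfile c A τ := fun τ => by
    linarith [one_le_radiusProfile hA0 c τ]
  have hκsq : ∀ τ, blowUpProfile τ ^ 2 ≤ 1 := fun τ => by
    nlinarith [neg_one_le_blowUpProfile τ, blowUpProfile_nonpos τ]
  have hevents := (eventually_energyMargin_scale_pos (contDiff_radiusProfile c A)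
      contDiff_blowUpProfile hρpos (isCompact_Icc (a := (-1 : ℝ)) (b := 7 / 2))
      (fun τ _ => hκsq τ) (Q ^ 2)).and
    (eventually_jangKR_scale_lt (contDiff_radiusProfile c A) contDiff_blowUpProfile hρpos
      (isCompact_Icc (a := (1 : ℝ)) (b := 7 / 2))
      (fun τ hτ => by rw [blowUpProfile_of_one_le hτ.1]; norm_num) hq)
  obtain ⟨ε, ⟨hmargin, hinner⟩, hε⟩ :=
    ((hevents.filter_mono nhdsWithin_le_nhds).and
      (self_mem_nhdsWithin : Set.Ioi (0 : ℝ) ∈ 𝓝[>] 0)).exists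
  set R := gluedRadius c A ε
  set k : ℝ → ℝ := fun t => blowUpProfile (ε * t)
  have hR : ContDiff ℝ ∞ R := contDiff_gluedRadius c A ε
  have hk : ContDiff ℝ ∞ k := contDiff_blowUpProfile.comp (contDiff_const.mul contDiff_id)
  have hRpos : ∀ ℓ, 0 < R ℓ := gluedRadius_pos hA0 c ε
  have hstart : ∀ ℓ, -(1 / ε) ≤ ℓ → -1 ≤ ε * ℓ := fun ℓ hℓ => by
    have := mul_le_mul_of_nonneg_left hℓ hε.le
    rwa [mul_neg, mul_one_div_cancel hε.ne'] at this
  have hslow : ∀ {ℓ}, ε * ℓ < 4 → R =ᶠ[𝓝 ℓ] fun t => radiusProfile c A (ε * t) :=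
    fun h => gluedRadius_eventuallyEq_radiusProfile c A hε h
  have hfast : ∀ {ℓ}, 3 < ε * ℓ → R =ᶠ[𝓝 ℓ] fun t => 1 + flare (t - 4 / ε) :=
    fun h => gluedRadius_eventuallyEq_flare c A hε h
  have hk0 : ∀ {ℓ}, 1 < ε * ℓ → k =ᶠ[𝓝 ℓ] fun _ => 0 :=
    fun h => blowUpProfile_scale_eventuallyEq_zero hε h
  -- In the flat exterior `R' = 1`, so `θ⁺ = 0` there means `R² = q = Q²`.
  have htail : ∀ ℓ, 4 / ε + 1 < ℓ → R ℓ = ℓ + (1 - 4 / ε) ∧ jangKR R k (Q ^ 2) ℓ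
      = -(Q ^ 2 / (ℓ + (1 - 4 / ε)) ^ 3) ∧ deriv R ℓ = 1 := by
    intro ℓ hℓ
    have h4 : 4 < ε * ℓ := (div_lt_iff₀' hε).1 (by linarith)
    have he : R =ᶠ[𝓝 ℓ] fun t => t + (1 - 4 / ε) := by
      filter_upwards [hfast (by linarith), Ioi_mem_nhds hℓ] with t h1 h2
      rw [h1, flare_of_one_le (by linarith [Set.mem_Ioi.1 h2])]
      ring
    refine ⟨he.eq_of_nhds, ?_, ?_⟩
    · rw [(jangKR_congr he (hk0 (by linarith)) _).eq_of_nhds]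
      simp [jangKR]
    · rw [he.deriv_eq]
      simp
  have hκ0 : blowUpProfile 0 = -1 := by
    rw [blowUpProfile, Real.smoothTransition.zero, add_zero]
  have hdk0 : deriv k 0 = 0 := by
    simp only [k, deriv_comp_mul_left_eq, mul_zero, deriv_blowUpProfile_zero]
  have hk00 : k 0 = -1 := by simp only [k, mul_zero, hκ0]
  have hR0 : R 0 = 1 + A := by
    rw [(hslow (by simp)).eq_of_nhds, mul_zero, radiusProfile_of_le_two c A (by norm_num)]
    simp
  have h2pos : 4 / ε + 1 < 4 / ε + Q - 1 := by linarith
  have hR2 : R (4 / ε + Q - 1) = Q := by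
    rw [(htail _ h2pos).1]
    ring
  have hε4 : 0 < 4 / ε := by positivity
  have hlt : R (4 / ε + Q - 1) < R 0 := by
    rw [hR2, hR0]
    linarith [Real.exp_pos c]
  refine ⟨SphericalData.ofJang R k (Q ^ 2) (-(1 / ε)) hR hk hRpos,
    SphericalData.ofJang_nonzeroK hq.ne', SphericalData.ofJang_dominantEnergy fun ℓ hℓ => ?_,
    SphericalData.decay_of_tail _ (1 - 4 / ε) (Q ^ 2) (4 / ε + 1) (fun ℓ hℓ => (htail ℓ hℓ).1)
      (fun ℓ hℓ => congrArg (fun r => 2 * Q ^ 2 / r ^ 3) (htail ℓ hℓ).1)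
      (fun ℓ hℓ => (htail ℓ hℓ).2.1),
    Or.inl (SphericalData.ofJang_negativeInnerExpansion fun ℓ hℓ => ?_),
    0, 4 / ε + Q - 1, neg_lt_zero.2 (by positivity), by linarith,
    SphericalData.ofJang_isMOTS (neg_nonpos.2 (by positivity)) ?_,
    SphericalData.ofJang_isMOTS ?_ ?_, hlt, ?_, k, ?_⟩
  · rcases le_or_gt (ε * ℓ) (7 / 2) with h | h
    · rw [energyMargin_congr (hslow (by linarith)) .rfl]
      exact (hmargin (ε * ℓ) ⟨hstart ℓ hℓ, h⟩ ℓ rfl).le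
    · rw [energyMargin_congr (hfast (by linarith)) (hk0 (by linarith)),
        energyMargin_comp_sub (fun t => 1 + flare t)]
      exact hflare _
  · rcases le_or_gt (ε * ℓ) (7 / 2) with h | h
    · have he := hslow (ℓ := ℓ) (by linarith)
      rw [(jangKR_congr he .rfl _).eq_of_nhds, he.deriv_eq, he.eq_of_nhds]
      rcases le_or_gt (ε * ℓ) 1 with h1 | h1
      · have hτ : ε * ℓ ∈ Set.Icc (-1 : ℝ) 1 := ⟨hstart ℓ hℓ, h1⟩
        have h2 := half_le_logDeriv_radiusProfile hc hAc hτ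
        exact jangKR_scale_lt_of_logDeriv hε hq.le (hρpos _) (neg_one_le_blowUpProfile _)
          (blowUpProfile_nonpos _) (by linarith [hcκ _ hτ]) (by linarith)
      · exact hinner _ ⟨h1.le, h⟩ ℓ rfl
    · have he := hfast (ℓ := ℓ) (by linarith)
      have h1 : 0 ≤ deriv R ℓ := by
        rw [he.deriv_eq]
        exact Monotone.deriv_nonneg fun x y hxy =>
          add_le_add le_rfl (monotone_flare (sub_le_sub_right hxy _))
      have h2 : jangKR R k (Q ^ 2) ℓ = -(Q ^ 2 / R ℓ ^ 3) := by
        rw [(jangKR_congr .rfl (hk0 (by linarith)) _).eq_of_nhds]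
        simp [jangKR]
      have h3 := hRpos ℓ
      rw [h2]
      exact (neg_lt_zero.2 (by positivity)).trans_le (by positivity)
  · rw [jangKR, hk00, hdk0]
    ring
  · have : 0 < 1 / ε := by positivity
    linarith
  · rw [(htail _ h2pos).2.1, (htail _ h2pos).2.2, ← (htail _ h2pos).1, hR2]
    field_simp
  · rw [SphericalData.sphereArea_eq, SphericalData.sphereArea_eq]
    have h0 : 0 ≤ R (4 / ε + Q - 1) := (hRpos _).le
    have : R (4 / ε + Q - 1) ^ 2 < R 0 ^ 2 := pow_lt_pow_left₀ hlt h0 two_ne_zero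
    exact mul_lt_mul_of_pos_left this (by positivity)
  · refine ⟨hk.contDiffOn, SphericalData.ofJang_solvesJang 0, hk00, ?_, fun ℓ hℓ => ?_, ?_⟩
    · rw [(hk.differentiable (by simp) 0).derivWithin (uniqueDiffOn_Ici 0 0 Set.self_mem_Ici), hdk0]
    · have h1 := Real.smoothTransition.pos_of_pos (mul_pos hε hℓ)
      have h2 := blowUpProfile_nonpos (ε * ℓ)
      rw [blowUpProfile] at h2
      exact abs_lt.2 ⟨by simp only [k, blowUpProfile]; linarith,
        by simp only [k, blowUpProfile]; linarith⟩
    · refine tendsto_const_nhds.congr' ?_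
      filter_upwards [eventually_gt_atTop (1 / ε)] with ℓ hℓ
      exact (hk0 ((div_lt_iff₀' hε).1 hℓ)).eq_of_nhds.symm
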